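/- Let $p,q\ge 1$ and $s\ge 3$ be integers, let $x_1,\dots,x_s$ be distinct points of $\mathbb{P}^1(\mathbb{C})$, put $D=x_1+\dots+x_s$, let $\mathcal K$ be the canonical bundle of $\mathbb{P}^1$, and let $a\in\mathbb{Z}$. Let $\alpha^j,\beta^j\in[0,1)$ ($1\le j\le s$) be real numbers such that $\alpha^j<\beta^j$ and $p\alpha^j+q\beta^j\in\mathbb{Z}$ for all $j$, such that $\epsilon:=\sum_j(\beta^j-\alpha^j)$ satisfies $$\epsilon<1\quad\text{and}\quad (2pq-p-q)\,\epsilon>2pq-2p-2q,$$ and such that $p\sum_j\alpha^j+q\sum_j\beta^j=(p+q)a-p$. Let $\mathcal U_\bullet$ be the bundle $\mathcal U=\mathbb{C}^p\otimes\mathcal O(-a+1)$ with, at each $x_j$, the trivial flag with the single weight $\alpha^j$ (of multiplicity $p$), and let $\mathcal V_\bullet$ be the bundle $\mathcal V=\mathbb{C}^q\otimes\mathcal O(-a)$ with, at each $x_j$, the trivial flag with the single weight $\beta^j$ (of multiplicity $q$). Fix a basis $b_1,\dots,b_{s-2}$ of $H^0(\mathcal O(s-3))$. For $\mathbf A=(A_1,\dots,A_{s-2})\in\mathrm{Hom}(\mathbb{C}^p,\mathbb{C}^q)^{s-2}$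 let $\gamma_{\mathbf A}=\sum_j A_j\otimes b_j$, a section of $\mathcal K(D)\otimes\mathrm{Hom}(\mathcal U,\mathcal V)\cong\mathrm{Hom}(\mathbb{C}^p,\mathbb{C}^q)\otimes\mathcal O(s-3)$. The parabolic $\mathrm{SU}(p,q)$ Higgs bundle $(\mathcal U_\bullet\oplus\mathcal V_\bullet,\gamma_{\mathbf A}\oplus 0)$ is called semistable if $\deg(\mathcal U'_\bullet)+\deg(\mathcal V'_\bullet)\le 0$ for all holomorphic sub-bundles $\mathcal U'\subset\mathcal U$, $\mathcal V'\subset\mathcal V$ with $\gamma_{\mathbf A}(\mathcal U')\subset\mathcal K(D)\otimes\mathcal V'$, where $\deg$ is the parabolic degree (the degree plus the sum of all weights, counted with multiplicity) for the induced parabolic structures; it is called stable if this inequality is strict whenever $\mathcal U'\oplus\mathcal V'$ is neither $0$ nor $\mathcal U\oplus\mathcal V$. Then: 1. $(\mathcal U_\bullet\oplus\mathcal V_\bullet,\gamma_{\mathbf A}\oplus 0)$ is semistable if and only if $\dim V'\ge\frac qp\dim U'$ for all linear subspaces $U'\subset\mathbb{C}^p$, $V'\subset\mathbb{C}^q$ with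 $A_j(U')\subset V'$ for all $j$. 2. $(\mathcal U_\bullet\oplus\mathcal V_\bullet,\gamma_{\mathbf A}\oplus 0)$ is stable if and only if, moreover, equality $\dim V'=\frac qp\dim U'$ for such a pair holds only when $U'=0,\ V'=0$ or when $U'=\mathbb{C}^p,\ V'=\mathbb{C}^q$. -/

import Mathlib

/-!
Parabolic `SU(p,q)` Higgs bundles over the punctured Riemann sphere and the Kronecker space
`Hom(ℂ^p, ℂ^q)^r`.

The Riemann sphere is `OnePoint ℂ`, with the coordinate `z` on `ℂ` and the coordinate `w = 1 / z`
around `∞`.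
-/

noncomputable section

namespace ParHiggs

/-- A holomorphic vector bundle of rank `r` over the Riemann sphere, obtained by gluing the trivial
bundles over the two affine charts along `ℂ ∖ {0}` (every holomorphic vector bundle over the sphere
arises in this way, since holomorphic vector bundles over `ℂ` are trivial).
A section is a pair `(f₀, f∞)` with `f∞ (1 / z) = T z * f₀ z` for `z ≠ 0`. -/
structure HolBundle (r : ℕ) where
  T : ℂ → Matrix (Fin r) (Fin r) ℂ
  holo : ∀ i j, DifferentiableOn ℂ (fun z => T z i j) {0}ᶜ
  det_ne_zero : ∀ z, z ≠ 0 → (T z).det ≠ 0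

/-- The degree of a bundle, i.e. the degree of its determinant line bundle: minus the winding number
of the transition function `det T` around `0`. -/
def HolBundle.degree {r : ℕ} (E : HolBundle r) : ℝ :=
  (-(2 * (Real.pi : ℂ) * Complex.I)⁻¹ *
    circleIntegral (logDeriv fun z => (E.T z).det) 0 1).re

/-- The bundle `ℂ^r ⊗ 𝒪(n)`: its sections are the pairs with `f∞ w = w ^ n • f₀ (1 / w)`. -/
def twist (r : ℕ) (n : ℤ) : HolBundle r where
  T z := z ^ (-n) • (1 : Matrix (Fin r) (Fin r) ℂ)
  holo i j := by
    intro z hz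
    have hz' : z ≠ 0 := hz
    simp only [Matrix.smul_apply, smul_eq_mul]
    exact ((differentiableAt_zpow.2 (Or.inl hz')).mul_const _).differentiableWithinAt
  det_ne_zero z hz := by
    rw [Matrix.det_smul, Matrix.det_one, mul_one]
    exact pow_ne_zero _ (zpow_ne_zero _ hz)

/-- A holomorphic sub-bundle of rank `m`: a bundle of rank `m` with a holomorphic bundle morphism
into `E` that is injective on every fibre. -/
structure Subbundle {r : ℕ} (E : HolBundle r) (m : ℕ) where
  bundle : HolBundle m
  incl₀ : ℂ → Matrix (Fin r) (Fin m) ℂ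
  inclInf : ℂ → Matrix (Fin r) (Fin m) ℂ
  holo₀ : ∀ i j, Differentiable ℂ fun z => incl₀ z i j
  holoInf : ∀ i j, Differentiable ℂ fun w => inclInf w i j
  compat : ∀ z, z ≠ 0 → inclInf z⁻¹ * bundle.T z = E.T z * incl₀ z
  inj₀ : ∀ z, Function.Injective (incl₀ z).mulVecLin
  injInf : ∀ w, Function.Injective (inclInf w).mulVecLin

/-- The inclusion of the fibres at a point `x` of the sphere. The fibre of a bundle of rank `r` is
identified with `ℂ^r` by the first trivialization if `x ∈ ℂ` and by the second one if `x = ∞`. -/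
def Subbundle.fibreMap {r m : ℕ} {E : HolBundle r} (F : Subbundle E m) (x : OnePoint ℂ) :
    (Fin m → ℂ) →ₗ[ℂ] (Fin r → ℂ) :=
  x.elim (F.inclInf 0).mulVecLin fun z => (F.incl₀ z).mulVecLin

theorem Subbundle.fibreMap_injective {r m : ℕ} {E : HolBundle r} (F : Subbundle E m)
    (x : OnePoint ℂ) : Function.Injective (F.fibreMap x) := by
  induction x using OnePoint.rec with
  | infty => exact F.injInf 0
  | coe z => exact F.inj₀ z

/-- A weighted flag with weights in `[0, 1)` in a vector space, written as a decreasing and left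
continuous filtration indexed by the weights. -/
structure WeightedFlag (W : Type) [AddCommGroup W] [Module ℂ W] where
  filt : ℝ → Submodule ℂ W
  anti : Antitone filt
  leftCont : ∀ t, ∃ ε > 0, filt (t - ε) = filt t
  filt_zero : filt 0 = ⊤
  filt_one : filt 1 = ⊥

/-- The step of the filtration just after `t`. -/
def WeightedFlag.after {W : Type} [AddCommGroup W] [Module ℂ W] (f : WeightedFlag W) (t : ℝ) :
    Submodule ℂ W :=
  ⨆ u ∈ Set.Ioi t, f.filt u

/-- The sum of the weights, i.e. of the jumps of the filtration, counted with multiplicity. -/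
def WeightedFlag.totalWeight {W : Type} [AddCommGroup W] [Module ℂ W] (f : WeightedFlag W) : ℝ :=
  ∑ᶠ t : ℝ, t * ((Module.finrank ℂ (f.filt t) : ℝ) - Module.finrank ℂ (f.after t))

/-- The flag induced on a subspace, given by an injective linear map. -/
def WeightedFlag.comap {W W' : Type} [AddCommGroup W] [Module ℂ W] [AddCommGroup W'] [Module ℂ W']
    (f : WeightedFlag W) (i : W' →ₗ[ℂ] W) (hi : Function.Injective i) : WeightedFlag W' where
  filt t := (f.filt t).comap i
  anti _ _ h := Submodule.comap_mono (f.anti h)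
  leftCont t := by
    obtain ⟨ε, hε, h⟩ := f.leftCont t
    exact ⟨ε, hε, by rw [h]⟩
  filt_zero := by rw [f.filt_zero, Submodule.comap_top]
  filt_one := by rw [f.filt_one, Submodule.comap_bot, LinearMap.ker_eq_bot.2 hi]

/-- The trivial flag with the single weight `c ∈ [0, 1)`. -/
def constFlag (W : Type) [AddCommGroup W] [Module ℂ W] (c : ℝ) (h0 : 0 ≤ c) (h1 : c < 1) :
    WeightedFlag W where
  filt t := if t ≤ c then ⊤ else ⊥
  anti t u h := by
    by_cases hu : u ≤ c
    · simp [hu, h.trans hu]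
    · simp [hu]
  leftCont t := by
    by_cases ht : t ≤ c
    · exact ⟨1, one_pos, by simp [ht, show t - 1 ≤ c by linarith]⟩
    · refine ⟨(t - c) / 2, by linarith, ?_⟩
      simp only [ht, if_false, ite_eq_right_iff]
      intro h
      exact absurd h (by linarith)
  filt_zero := by simp [h0]
  filt_one := by simp [h1]

theorem constFlag_after {W : Type} [AddCommGroup W] [Module ℂ W] (c : ℝ) (h0 : 0 ≤ c)
    (h1 : c < 1) (t : ℝ) :
    (constFlag W c h0 h1).after t = if t < c then ⊤ else ⊥ := by
  unfold WeightedFlag.after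
  by_cases h : t < c
  · rw [if_pos h, eq_top_iff]
    refine le_iSup₂_of_le c h ?_
    simp [constFlag]
  · rw [if_neg h, eq_bot_iff]
    refine iSup₂_le fun u hu => ?_
    have : ¬ u ≤ c := fun h' => h (lt_of_lt_of_le hu h')
    simp [constFlag, this]

theorem constFlag_totalWeight (r : ℕ) (c : ℝ) (h0 : 0 ≤ c) (h1 : c < 1) :
    (constFlag (Fin r → ℂ) c h0 h1).totalWeight = r * c := by
  have hf : ∀ t, (constFlag (Fin r → ℂ) c h0 h1).filt t = if t ≤ c then ⊤ else ⊥ := fun _ => rfl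
  unfold WeightedFlag.totalWeight
  rw [finsum_eq_single _ c]
  · rw [constFlag_after, hf, if_pos le_rfl, if_neg (lt_irrefl c)]
    simp [mul_comm]
  · intro t ht
    rw [constFlag_after, hf]
    rcases lt_or_gt_of_ne ht with h | h
    · rw [if_pos h, if_pos h.le, sub_self, mul_zero]
    · rw [if_neg (not_lt.2 h.le), if_neg (not_le.2 h), sub_self, mul_zero]

/-- A parabolic bundle of rank `r` over the sphere punctured at the points `x j`: a holomorphic
vector bundle with a weighted flag in the fibre over each puncture. -/
structure ParBundle {s : ℕ} (x : Fin s → OnePoint ℂ) (r : ℕ) extends HolBundle r where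
  flag : Fin s → WeightedFlag (Fin r → ℂ)

/-- The parabolic degree. -/
def ParBundle.parDegree {s r : ℕ} {x : Fin s → OnePoint ℂ} (E : ParBundle x r) : ℝ :=
  E.toHolBundle.degree + ∑ j, (E.flag j).totalWeight

/-- A sub-bundle of a parabolic bundle with the induced parabolic structure. -/
def ParBundle.induced {s r m : ℕ} {x : Fin s → OnePoint ℂ} (E : ParBundle x r)
    (F : Subbundle E.toHolBundle m) : ParBundle x m where
  toHolBundle := F.bundle
  flag j := (E.flag j).comap (F.fibreMap (x j)) (F.fibreMap_injective (x j))

/-- `dz / poles₀ x z` generates the line bundle `𝒦(D)`, `D = ∑ j, x j`, over the first chart. -/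
def poles₀ {s : ℕ} (x : Fin s → OnePoint ℂ) (z : ℂ) : ℂ :=
  ∏ j, (x j).elim 1 fun c => z - c

/-- `dw / polesInf x w` generates the line bundle `𝒦(D)`, `D = ∑ j, x j`, over the chart around
`∞`; a puncture `c ≠ 0` in `ℂ` has the coordinate `w = 1 / c`, and the puncture `∞` has `w = 0`. -/
def polesInf {s : ℕ} (x : Fin s → OnePoint ℂ) (w : ℂ) : ℂ :=
  ∏ j, (x j).elim w fun c => if c = 0 then 1 else w - c⁻¹

/-- A holomorphic section of `𝒦(D) ⊗ Hom(E, F)`. It is `(dz / poles₀ x z) • coeff₀ z` over the first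
chart and `(dw / polesInf x w) • coeffInf w` over the second one; these agree for `z ≠ 0`,
where `w = 1 / z` and `dw = -dz / z ^ 2`. -/
structure LogHom {s p q : ℕ} (x : Fin s → OnePoint ℂ) (E : HolBundle p) (F : HolBundle q) where
  coeff₀ : ℂ → Matrix (Fin q) (Fin p) ℂ
  coeffInf : ℂ → Matrix (Fin q) (Fin p) ℂ
  holo₀ : ∀ i j, Differentiable ℂ fun z => coeff₀ z i j
  holoInf : ∀ i j, Differentiable ℂ fun w => coeffInf w i j
  compat : ∀ z, z ≠ 0 →
    (poles₀ x z * -(z ^ 2)⁻¹) • (coeffInf z⁻¹ * E.T z) = polesInf x z⁻¹ • (F.T z * coeff₀ z)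

/-- The value of a section of `𝒦(D) ⊗ Hom(E, F)` at a point, in the local generators of `𝒦(D)`
chosen above. At a puncture this is a nonzero multiple of the residue. -/
def LogHom.fibreMap {s p q : ℕ} {x : Fin s → OnePoint ℂ} {E : HolBundle p} {F : HolBundle q}
    (φ : LogHom x E F) (y : OnePoint ℂ) : (Fin p → ℂ) →ₗ[ℂ] (Fin q → ℂ) :=
  y.elim (φ.coeffInf 0).mulVecLin fun z => (φ.coeff₀ z).mulVecLin

/-- The zero section. -/
def LogHom.zero {s p q : ℕ} (x : Fin s → OnePoint ℂ) (E : HolBundle p) (F : HolBundle q) :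
    LogHom x E F where
  coeff₀ _ := 0
  coeffInf _ := 0
  holo₀ i j := by simp
  holoInf i j := by simp
  compat z _ := by simp

/-- The section is (strongly) parabolic: over each puncture it strictly increases the weights. -/
def IsParabolic {s p q : ℕ} {x : Fin s → OnePoint ℂ} (E : ParBundle x p) (F : ParBundle x q)
    (φ : LogHom x E.toHolBundle F.toHolBundle) : Prop :=
  ∀ j t, ((E.flag j).filt t).map (φ.fibreMap (x j)) ≤ (F.flag j).after t

/-- A parabolic `SU(p,q)` Higgs bundle `(U ⊕ V, γ ⊕ δ)` over the punctured sphere. The last two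
fields say that `det U ⊗ det V` has the trivial parabolic structure and is the trivial line bundle,
that is, of degree `0`. -/
structure SUHiggsBundle {s : ℕ} (x : Fin s → OnePoint ℂ) (p q : ℕ) where
  U : ParBundle x p
  V : ParBundle x q
  γ : LogHom x U.toHolBundle V.toHolBundle
  δ : LogHom x V.toHolBundle U.toHolBundle
  γ_parabolic : IsParabolic U V γ
  δ_parabolic : IsParabolic V U δ
  det_weights : ∀ j, ∃ k : ℤ, (U.flag j).totalWeight + (V.flag j).totalWeight = k
  det_degree : U.parDegree + V.parDegree = 0

namespace SUHiggsBundle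

variable {s p q : ℕ} {x : Fin s → OnePoint ℂ}

/-- The sub-bundle `U' ⊕ V'` is invariant under the Higgs field `γ ⊕ δ`. -/
def Invariant (H : SUHiggsBundle x p q) {m n : ℕ} (U' : Subbundle H.U.toHolBundle m)
    (V' : Subbundle H.V.toHolBundle n) : Prop :=
  ∀ y : OnePoint ℂ,
    (LinearMap.range (U'.fibreMap y)).map (H.γ.fibreMap y) ≤ LinearMap.range (V'.fibreMap y) ∧
    (LinearMap.range (V'.fibreMap y)).map (H.δ.fibreMap y) ≤ LinearMap.range (U'.fibreMap y)

/-- Every invariant sub-bundle `U' ⊕ V'` has parabolic degree `≤ 0`. -/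
def Semistable (H : SUHiggsBundle x p q) : Prop :=
  ∀ (m n : ℕ) (U' : Subbundle H.U.toHolBundle m) (V' : Subbundle H.V.toHolBundle n),
    H.Invariant U' V' → (H.U.induced U').parDegree + (H.V.induced V').parDegree ≤ 0

/-- Every invariant sub-bundle `U' ⊕ V'` other than `0` and `U ⊕ V` has parabolic degree `< 0`. -/
def Stable (H : SUHiggsBundle x p q) : Prop :=
  ∀ (m n : ℕ) (U' : Subbundle H.U.toHolBundle m) (V' : Subbundle H.V.toHolBundle n),
    H.Invariant U' V' → ¬(m = 0 ∧ n = 0) → ¬(m = p ∧ n = q) →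
      (H.U.induced U').parDegree + (H.V.induced V').parDegree < 0

end SUHiggsBundle

/-- King's condition for semistability in `Hom(ℂ^p, ℂ^q)^r`. -/
def KingSemistable {p q r : ℕ} (A : Fin r → (Fin p → ℂ) →ₗ[ℂ] (Fin q → ℂ)) : Prop :=
  ∀ (U' : Submodule ℂ (Fin p → ℂ)) (V' : Submodule ℂ (Fin q → ℂ)),
    (∀ j, U'.map (A j) ≤ V') →
      (q : ℝ) / p * Module.finrank ℂ U' ≤ Module.finrank ℂ V'

/-- King's condition for stability in `Hom(ℂ^p, ℂ^q)^r`. -/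
def KingStable {p q r : ℕ} (A : Fin r → (Fin p → ℂ) →ₗ[ℂ] (Fin q → ℂ)) : Prop :=
  KingSemistable A ∧
    ∀ (U' : Submodule ℂ (Fin p → ℂ)) (V' : Submodule ℂ (Fin q → ℂ)),
      (∀ j, U'.map (A j) ≤ V') →
        (Module.finrank ℂ V' : ℝ) = (q : ℝ) / p * Module.finrank ℂ U' →
          (U' = ⊥ ∧ V' = ⊥) ∨ (U' = ⊤ ∧ V' = ⊤)

/-- The constant `SU(p,q)`-multiweights `(α, β)` under consideration. The number
`ε = ∑ j, (β j - α j)` lies in the interval `((2pq-2p-2q)/(2pq-p-q), 1)`, and `degree_zero` says that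
`ℂ^p ⊗ 𝒪(-a+1) ⊕ ℂ^q ⊗ 𝒪(-a)` with these weights has parabolic degree `0`. -/
structure ConstWeights (p q s : ℕ) (a : ℤ) (α β : Fin s → ℝ) : Prop where
  α_nonneg : ∀ j, 0 ≤ α j
  α_lt_one : ∀ j, α j < 1
  β_nonneg : ∀ j, 0 ≤ β j
  β_lt_one : ∀ j, β j < 1
  integral : ∀ j, ∃ k : ℤ, p * α j + q * β j = k
  lt : ∀ j, α j < β j
  lower : (2 * p * q - 2 * p - 2 * q : ℝ) < (2 * p * q - p - q) * ∑ j, (β j - α j)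
  upper : ∑ j, (β j - α j) < 1
  degree_zero : p * (-a + 1 : ℝ) + q * (-a : ℝ) + (p * ∑ j, α j + q * ∑ j, β j) = 0

/-- `ℂ^r ⊗ 𝒪(n)` with the trivial flag of weight `c j` over the puncture `x j`. -/
def constPar {s : ℕ} (x : Fin s → OnePoint ℂ) (r : ℕ) (n : ℤ) (c : Fin s → ℝ)
    (h0 : ∀ j, 0 ≤ c j) (h1 : ∀ j, c j < 1) : ParBundle x r where
  toHolBundle := twist r n
  flag j := constFlag (Fin r → ℂ) (c j) (h0 j) (h1 j)

theorem twist_degree (r : ℕ) (n : ℤ) : (twist r n).degree = r * n := by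
  have h1 : (fun z : ℂ => ((twist r n).T z).det) = fun z => z ^ (-n * r) := by
    funext z
    simp only [twist, Matrix.det_smul, Matrix.det_one, mul_one, Fintype.card_fin]
    rw [← zpow_natCast, ← zpow_mul]
  have h2 : circleIntegral (logDeriv fun z : ℂ => z ^ (-n * r)) 0 1
      = ((-n * r : ℤ) : ℂ) * (2 * Real.pi * Complex.I) := by
    rw [← circleIntegral.integral_sub_center_inv (0 : ℂ) (one_ne_zero (α := ℝ)),
      ← circleIntegral.integral_const_mul]
    congr 1
    funext z
    rw [logDeriv_apply, deriv_zpow, sub_zero]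
    by_cases hz : z = 0
    · subst hz
      by_cases hk : -n * r = 0
      · simp [hk]
      · rw [zero_zpow _ hk, div_zero, inv_zero, mul_zero]
    · rw [zpow_sub_one₀ hz]
      have := zpow_ne_zero (-n * r) hz
      field_simp
  unfold HolBundle.degree
  rw [h1, h2]
  have hpi : (2 * (Real.pi : ℂ) * Complex.I) ≠ 0 := Complex.two_pi_I_ne_zero
  have : -(2 * (Real.pi : ℂ) * Complex.I)⁻¹ * (((-n * r : ℤ) : ℂ) * (2 * Real.pi * Complex.I))
      = (((r : ℝ) * (n : ℝ) : ℝ) : ℂ) := by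
    push_cast
    field_simp
  rw [this, Complex.ofReal_re]

theorem constPar_parDegree {s : ℕ} (x : Fin s → OnePoint ℂ) (r : ℕ) (n : ℤ) (c : Fin s → ℝ)
    (h0 : ∀ j, 0 ≤ c j) (h1 : ∀ j, c j < 1) :
    (constPar x r n c h0 h1).parDegree = r * n + r * ∑ j, c j := by
  unfold ParBundle.parDegree
  rw [show (constPar x r n c h0 h1).toHolBundle = twist r n from rfl, twist_degree, Finset.mul_sum]
  congr 1
  exact Finset.sum_congr rfl fun j _ => constFlag_totalWeight r (c j) (h0 j) (h1 j)

/-- The constant by which the generators of `𝒦(D)` over the two charts differ. -/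
def transConst {s : ℕ} (x : Fin s → OnePoint ℂ) : ℂ :=
  ∏ j, (x j).elim 1 fun c => if c = 0 then 1 else -c⁻¹

theorem polesInf_inv {s : ℕ} (x : Fin s → OnePoint ℂ) (z : ℂ) (hz : z ≠ 0) :
    polesInf x z⁻¹ * z ^ s = transConst x * poles₀ x z := by
  have hs : z ^ s = ∏ _j : Fin s, z := by simp
  rw [hs, polesInf, transConst, poles₀, ← Finset.prod_mul_distrib, ← Finset.prod_mul_distrib]
  refine Finset.prod_congr rfl fun j _ => ?_
  induction x j using OnePoint.rec with
  | infty => simp [hz]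
  | coe c =>
    by_cases hc : c = 0
    · simp [hc]
    · simp only [OnePoint.elim_some, hc, if_false]
      field_simp
      ring

theorem reflect_eval {s : ℕ} (P : Polynomial ℂ) (hP : P ∈ Polynomial.degreeLT ℂ (s - 2))
    (hs : 3 ≤ s) (z : ℂ) (hz : z ≠ 0) :
    (P.reflect (s - 3)).eval z⁻¹ * z ^ (s - 3) = P.eval z := by
  have hd : P.natDegree ≤ s - 3 := by
    rw [Polynomial.mem_degreeLT] at hP
    rw [Polynomial.natDegree_le_iff_degree_le]
    by_cases h : P = 0
    · simp [h]
    · rw [Polynomial.degree_eq_natDegree h] at hP ⊢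
      have : P.natDegree < s - 2 := by exact_mod_cast hP
      exact_mod_cast (by omega : P.natDegree ≤ s - 3)
  let := invertibleOfNonzero hz
  have := Polynomial.eval₂_reflect_mul_pow (RingHom.id ℂ) z (s - 3) P hd
  simpa [Polynomial.eval₂_id, invOf_eq_inv] using this

/-- The section `γ_A = ∑ j, A_j ⊗ b_j` of `𝒦(D) ⊗ Hom(ℂ^p ⊗ 𝒪(-a+1), ℂ^q ⊗ 𝒪(-a))`, which is
`Hom(ℂ^p, ℂ^q) ⊗ 𝒪(s-3)`, attached to a basis `b` of the space `H⁰(𝒪(s-3))` of polynomials of degree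
at most `s - 3`. -/
def gammaA {p q s : ℕ} (x : Fin s → OnePoint ℂ) (a : ℤ)
    (b : Module.Basis (Fin (s - 2)) ℂ (Polynomial.degreeLT ℂ (s - 2)))
    (A : Fin (s - 2) → (Fin p → ℂ) →ₗ[ℂ] (Fin q → ℂ)) :
    LogHom x (twist p (-a + 1)) (twist q (-a)) where
  coeff₀ z := ∑ j, (b j : Polynomial ℂ).eval z • LinearMap.toMatrix' (A j)
  coeffInf w := -transConst x •
    ∑ j, ((b j : Polynomial ℂ).reflect (s - 3)).eval w • LinearMap.toMatrix' (A j)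
  holo₀ k l := by
    simp only [Matrix.sum_apply, Matrix.smul_apply, smul_eq_mul]
    fun_prop
  holoInf k l := by
    simp only [Matrix.sum_apply, Matrix.smul_apply, smul_eq_mul]
    fun_prop
  compat z hz := by
    simp only [twist, Matrix.mul_smul, Matrix.smul_mul, Matrix.mul_one, Matrix.one_mul,
      Finset.smul_sum, smul_smul]
    refine Finset.sum_congr rfl fun j _ => ?_
    have hs : 3 ≤ s := by have := j.2; omega
    congr 1
    rw [← reflect_eval (b j : Polynomial ℂ) (b j).2 hs z hz]
    have h := polesInf_inv x z hz
    have h3 : z ^ s = z ^ (s - 3) * z ^ 3 := by rw [← pow_add]; congr 1; omega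
    have h4 : z ^ (-(-a)) = z ^ (-(-a + 1)) * z := by
      rw [← zpow_add_one₀ hz]; congr 1; ring
    rw [h4]
    rw [h3] at h
    have h5 : poles₀ x z * -(z ^ 2)⁻¹ * (-transConst x) = polesInf x z⁻¹ * z ^ (s - 3) * z := by
      have hz2 : (z ^ 2) ≠ 0 := pow_ne_zero 2 hz
      generalize polesInf x z⁻¹ = y at h
      field_simp
      linear_combination -h
    linear_combination (((b j : Polynomial ℂ).reflect (s - 3)).eval z⁻¹ * z ^ (-(-a + 1))) * h5

/-- The parabolic `SU(p,q)` Higgs bundle `(U ⊕ V, γ_A ⊕ 0)` with `U = ℂ^p ⊗ 𝒪(-a+1)`,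
`V = ℂ^q ⊗ 𝒪(-a)` and the trivial flags of weights `α j`, `β j` over the puncture `x j`. -/
def higgsOf {p q s : ℕ} (x : Fin s → OnePoint ℂ) (a : ℤ) (α β : Fin s → ℝ)
    (hW : ConstWeights p q s a α β)
    (b : Module.Basis (Fin (s - 2)) ℂ (Polynomial.degreeLT ℂ (s - 2)))
    (A : Fin (s - 2) → (Fin p → ℂ) →ₗ[ℂ] (Fin q → ℂ)) : SUHiggsBundle x p q where
  U := constPar x p (-a + 1) α hW.α_nonneg hW.α_lt_one
  V := constPar x q (-a) β hW.β_nonneg hW.β_lt_one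
  γ := gammaA x a b A
  δ := LogHom.zero x _ _
  γ_parabolic := by
    intro j t
    simp only [constPar, constFlag_after]
    by_cases h : t < β j
    · simp [h]
    · have : ¬ t ≤ α j := fun h' => h (lt_of_le_of_lt h' (hW.lt j))
      simp [constFlag, this]
  δ_parabolic := by
    intro j t
    have : ∀ y, (LogHom.zero x (constPar x q (-a) β hW.β_nonneg hW.β_lt_one).toHolBundle
        (constPar x p (-a + 1) α hW.α_nonneg hW.α_lt_one).toHolBundle).fibreMap y = 0 := by
      intro y
      induction y using OnePoint.rec <;> simp [LogHom.fibreMap, LogHom.zero]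
    rw [this]
    simp
  det_weights := by
    intro j
    obtain ⟨k, hk⟩ := hW.integral j
    exact ⟨k, by simp only [constPar, constFlag_totalWeight, hk]⟩
  det_degree := by
    rw [constPar_parDegree, constPar_parDegree]
    push_cast
    linarith [hW.degree_zero]

end ParHiggs

end

/-! ### Winding numbers of zero-free functions on the punctured plane. -/

noncomputable section

namespace ParHiggs

open Complex Real Metric Filter Topology

/-! A sub-bundle of rank `m` of `ℂ^r ⊗ 𝒪(n)` has degree `mn - d` with `d ≥ 0`, and `d = 0` forces it
to be constant, that is, a fixed subspace of `ℂ^r` tensored with `𝒪(n)`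
(`Subbundle.exists_degree_eq`). Indeed a maximal minor of the inclusion that is not identically zero
is a section of a line bundle whose transition function has winding number `d`. Jensen's formula
gives `d ≥ 0` (`HasWinding.nonneg`), and dividing out a zero gives `d > 0` if the minor vanishes
somewhere (`HasWinding.pos_of_zero`). If it vanishes nowhere, the inclusion normalized by this minor
is constant by Liouville.

The flags are trivial, so the parabolic degree of a pair of ranks `m`, `n` and defects `d₁`, `d₂` is
`κ (mq - np) - d₁ - d₂`, where `κ = (1 - ε)/(p + q) > 0`. The lower bound on `ε` makes this negative
as soon as `d₁ + d₂ ≥ 1` (`ConstWeights.parDegree_neg`). Only constant pairs `(W₁, W₂)` can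
therefore violate (semi)stability. Such a pair is invariant exactly when every `A j` maps `W₁` into
`W₂`, because the `b j` are linearly independent (`gammaA_map_le_iff`), and the sign of `mq - np` is
then King's condition. -/

/-- A function on `ℂ ∖ {0}` has winding number `d` around `0` if it has a holomorphic logarithm
on the universal cover `exp : ℂ → ℂ ∖ {0}` with monodromy `2πid`. -/
def HasWinding (u : ℂ → ℂ) (d : ℤ) : Prop :=
  ∃ k : ℂ → ℂ, Differentiable ℂ k ∧ (∀ ζ, cexp (k ζ) = u (cexp ζ)) ∧
    ∀ ζ, k (ζ + 2 * π * I) = k ζ + d * (2 * π * I)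

/-- The pullback by `exp` is entire without zeros, so its logarithmic derivative has a primitive,
which is the required logarithm. The logarithmic derivative is periodic, so the primitive changes by
a constant over a period, and that constant exponentiates to `1`. -/
theorem exists_hasWinding {u : ℂ → ℂ} (hu : DifferentiableOn ℂ u {0}ᶜ)
    (h0 : ∀ z, z ≠ 0 → u z ≠ 0) : ∃ d, HasWinding u d := by
  have hv : Differentiable ℂ fun ζ => u (cexp ζ) := fun ζ =>
    DifferentiableAt.comp ζ
      (hu.differentiableAt (isOpen_compl_singleton.mem_nhds (Complex.exp_ne_zero ζ)))
      Complex.differentiable_exp.differentiableAt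
  have hv0 : ∀ ζ, u (cexp ζ) ≠ 0 := fun ζ => h0 _ (Complex.exp_ne_zero ζ)
  set v : ℂ → ℂ := fun ζ => u (cexp ζ) with hvdef
  have hl : Differentiable ℂ (logDeriv v) := by
    have h1 : Differentiable ℂ (deriv v) := hv.deriv
    exact fun ζ => (h1 ζ).div (hv ζ) (hv0 ζ)
  obtain ⟨k, hk0, hk⟩ := hl.isExactOn_univ.with_val_at 0 (Complex.log (v 0))
  have hk : ∀ ζ, HasDerivAt k (logDeriv v ζ) ζ := fun ζ => hk ζ trivial
  have hkd : Differentiable ℂ k := fun ζ => (hk ζ).differentiableAt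
  have hexp : ∀ ζ, cexp (k ζ) = v ζ := by
    have hd : ∀ ζ, HasDerivAt (fun ζ => cexp (-k ζ) * v ζ) 0 ζ := by
      intro ζ
      have := ((hk ζ).fun_neg.cexp).fun_mul (hv ζ).hasDerivAt
      have h1 : v ζ ≠ 0 := hv0 ζ
      have h2 : cexp (-k ζ) * -logDeriv v ζ * v ζ + cexp (-k ζ) * deriv v ζ = 0 := by
        rw [logDeriv_apply]
        field_simp
        ring
      rwa [h2] at this
    intro ζ
    have h := is_const_of_deriv_eq_zero (fun ζ => (hd ζ).differentiableAt)
      (fun ζ => (hd ζ).deriv) ζ 0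
    rw [hk0, Complex.exp_neg, Complex.exp_neg, Complex.exp_log (hv0 0),
      inv_mul_cancel₀ (hv0 0)] at h
    rw [inv_mul_eq_one₀ (Complex.exp_ne_zero _)] at h
    exact h
  have hper : ∀ ζ, v (ζ + 2 * π * I) = v ζ := fun ζ => by
    simp only [hvdef, Complex.exp_periodic ζ]
  have hlper : ∀ ζ, logDeriv v (ζ + 2 * π * I) = logDeriv v ζ := fun ζ => by
    rw [logDeriv_apply, logDeriv_apply, hper, ← deriv_comp_add_const]
    congr 2
    funext ζ
    exact hper ζ
  have hconst : ∀ ζ, k (ζ + 2 * π * I) - k ζ = k (0 + 2 * π * I) - k 0 := by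
    have hd : ∀ ζ, HasDerivAt (fun ζ => k (ζ + 2 * π * I) - k ζ) 0 ζ := by
      intro ζ
      have := ((hk (ζ + 2 * π * I)).comp_add_const ζ (2 * π * I)).fun_sub (hk ζ)
      rwa [hlper, sub_self] at this
    exact fun ζ => is_const_of_deriv_eq_zero (fun ζ => (hd ζ).differentiableAt)
      (fun ζ => (hd ζ).deriv) ζ 0
  have hone : cexp (k (0 + 2 * π * I) - k 0) = 1 := by
    rw [Complex.exp_sub, hexp, hexp, hper, div_self (hv0 0)]
  obtain ⟨d, hd⟩ := Complex.exp_eq_one_iff.1 hone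
  refine ⟨d, k, hkd, hexp, fun ζ => ?_⟩
  rw [← hd, ← hconst ζ]
  ring

namespace HasWinding

variable {u : ℂ → ℂ} {d : ℤ}

theorem mul_zpow (h : HasWinding u d) (j : ℤ) : HasWinding (fun z => z ^ j * u z) (d + j) := by
  obtain ⟨k, hk, he, hp⟩ := h
  refine ⟨fun ζ => j * ζ + k ζ, by fun_prop, fun ζ => ?_, fun ζ => ?_⟩
  · rw [Complex.exp_add, he, Complex.exp_int_mul]
  · beta_reduce
    rw [hp]
    push_cast
    ring

theorem inv (h : HasWinding u d) : HasWinding (fun z => (u z)⁻¹) (-d) := by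
  obtain ⟨k, hk, he, hp⟩ := h
  refine ⟨fun ζ => -k ζ, by fun_prop, fun ζ => ?_, fun ζ => ?_⟩
  · rw [Complex.exp_neg, he]
  · beta_reduce
    rw [hp]
    push_cast
    ring

theorem ne_zero (h : HasWinding u d) {z : ℂ} (hz : z ≠ 0) : u z ≠ 0 := by
  obtain ⟨k, hk, he, hp⟩ := h
  rw [← Complex.exp_log hz, ← he]
  exact Complex.exp_ne_zero _

/-- Along the unit circle the integrand is the derivative of `θ ↦ k (θ * I)`, so the integral is the
monodromy of `k`. This links the contour integral in `HolBundle.degree` to `HasWinding`. -/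
theorem circleIntegral_logDeriv (h : HasWinding u d) (hu : DifferentiableOn ℂ u {0}ᶜ) :
    circleIntegral (logDeriv u) 0 1 = d * (2 * π * I) := by
  obtain ⟨k, hk, he, hp⟩ := h
  have hder : ∀ ζ, deriv k ζ = logDeriv u (cexp ζ) * cexp ζ := by
    intro ζ
    have hud : DifferentiableAt ℂ u (cexp ζ) :=
      hu.differentiableAt (isOpen_compl_singleton.mem_nhds (Complex.exp_ne_zero ζ))
    have h1 : HasDerivAt (fun ζ => cexp (k ζ)) (cexp (k ζ) * deriv k ζ) ζ :=
      (hk ζ).hasDerivAt.cexp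
    have h2 : HasDerivAt (fun ζ => u (cexp ζ)) (deriv u (cexp ζ) * cexp ζ) ζ :=
      hud.hasDerivAt.comp ζ (Complex.hasDerivAt_exp ζ)
    rw [funext he] at h1
    have h3 := h1.unique h2
    rw [he] at h3
    have h4 : u (cexp ζ) ≠ 0 := by rw [← he]; exact Complex.exp_ne_zero _
    rw [logDeriv_apply]
    field_simp
    linear_combination h3
  have hF : ∀ θ : ℝ, HasDerivAt (fun θ : ℝ => k (θ * I)) (deriv k (θ * I) * I) θ := by
    intro θ
    have h1 : HasDerivAt (fun ζ : ℂ => k (ζ * I)) (deriv k (θ * I) * I) (θ : ℂ) := by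
      have h2 : HasDerivAt (fun ζ : ℂ => ζ * I) I (θ : ℂ) := hasDerivAt_mul_const I
      exact (hk (θ * I)).hasDerivAt.comp (θ : ℂ) h2
    exact h1.comp_ofReal
  have hc : Continuous fun θ : ℝ => deriv k (θ * I) * I := by
    have : Continuous (deriv k) := hk.deriv.continuous
    fun_prop
  have hint := intervalIntegral.integral_eq_sub_of_hasDerivAt (a := 0) (b := 2 * π)
    (fun θ _ => hF θ) (hc.intervalIntegrable _ _)
  rw [circleIntegral]
  have heq : ∀ θ : ℝ, deriv (circleMap 0 1) θ • logDeriv u (circleMap 0 1 θ)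
      = deriv k (θ * I) * I := by
    intro θ
    rw [hder, deriv_circleMap, circleMap_zero]
    simp only [ofReal_one, one_mul, smul_eq_mul]
    ring
  simp_rw [heq, hint]
  have := hp 0
  push_cast
  rw [zero_add] at this
  rw [this]
  simp

theorem log_norm_exp {k : ℂ → ℂ} (he : ∀ ζ, cexp (k ζ) = u (cexp ζ)) (ζ : ℂ) :
    Real.log ‖u (cexp ζ)‖ = (k ζ).re := by
  rw [← he, Complex.norm_exp, Real.log_exp]

/-- The average is the mean of `(k ζ).re` over a vertical segment of length `2π` at abscissa `τ`.
Cauchy's theorem on the rectangle with corners `0` and `τ + 2πi` compares it with the segment at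
abscissa `0`; the horizontal sides differ by the monodromy, which gives the linear term. -/
theorem circleAverage_log_norm (h : HasWinding u d) :
    ∃ C : ℝ, ∀ τ : ℝ, circleAverage (fun z => Real.log ‖u z‖) 0 (Real.exp τ) = d * τ + C := by
  obtain ⟨k, hk, he, hp⟩ := h
  have hkc := hk.continuous
  have havg : ∀ τ : ℝ, circleAverage (fun z => Real.log ‖u z‖) 0 (Real.exp τ)
      = (2 * π)⁻¹ * (∫ θ in (0 : ℝ)..2 * π, k (τ + θ * I)).re := by
    intro τ
    rw [circleAverage_def, smul_eq_mul]
    congr 1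
    have h1 : ∀ θ : ℝ, Real.log ‖u (circleMap 0 (Real.exp τ) θ)‖ = (k (τ + θ * I)).re := by
      intro θ
      rw [← log_norm_exp he, Complex.exp_add, circleMap_zero]
      push_cast
      rfl
    simp_rw [h1]
    have hi : IntervalIntegrable (fun θ : ℝ => k (τ + θ * I)) MeasureTheory.volume 0 (2 * π) :=
      Continuous.intervalIntegrable (by fun_prop) _ _
    have := Complex.reCLM.intervalIntegral_comp_comm hi
    simpa using this
  refine ⟨(2 * π)⁻¹ * (∫ θ in (0 : ℝ)..2 * π, k (((0 : ℝ) : ℂ) + θ * I)).re, fun τ => ?_⟩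
  rw [havg]
  have hrect := Complex.integral_boundary_rect_eq_zero_of_differentiableOn k 0 (τ + (2 * π : ℝ) * I)
    hk.differentiableOn
  have hsub : (∫ x in (0 : ℝ)..τ, k (x + ((2 * π : ℝ) : ℂ) * I))
      = (∫ x in (0 : ℝ)..τ, k (x + ((0 : ℝ) : ℂ) * I)) + τ * (d * (2 * π * I)) := by
    have h1 : ∀ x : ℝ, k (x + ((2 * π : ℝ) : ℂ) * I)
        = k (x + ((0 : ℝ) : ℂ) * I) + d * (2 * π * I) := by
      intro x
      have := hp x
      push_cast
      simpa using this
    simp_rw [h1]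
    rw [intervalIntegral.integral_add (Continuous.intervalIntegrable (by fun_prop) _ _)
      (by simp), intervalIntegral.integral_const, sub_zero, Complex.real_smul]
  simp only [add_re, mul_re, ofReal_re, I_re, mul_zero, ofReal_im, I_im, mul_one, sub_self, add_zero,
    add_im, mul_im, zero_add, zero_re, zero_im, smul_eq_mul] at hrect
  rw [hsub] at hrect
  set P := ∫ θ in (0 : ℝ)..2 * π, k (τ + θ * I)
  set Q := ∫ θ in (0 : ℝ)..2 * π, k (((0 : ℝ) : ℂ) + θ * I)
  have hPQ : P = Q + ((d * τ * (2 * π) : ℝ) : ℂ) := by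
    push_cast
    linear_combination -I * hrect + (P - Q - d * τ * (2 * π)) * Complex.I_sq
  rw [hPQ, add_re, ofReal_re]
  have := Real.pi_ne_zero
  field_simp
  ring

end HasWinding

/-! ### Sections of line bundles on the sphere and the sign of the winding number. -/

/-- Jensen's formula: the divisor terms are nonnegative because `f` has no poles and `ρ ≥ 1`. The
trailing coefficient replaces `f 0`, which may vanish; the bound is independent of `ρ`. -/
theorem log_norm_trailingCoeff_le_circleAverage {f : ℂ → ℂ} (hf : Differentiable ℂ f) {ρ : ℝ}
    (hρ : 1 ≤ ρ) :
    Real.log ‖meromorphicTrailingCoeffAt f 0‖ ≤ circleAverage (fun z => Real.log ‖f z‖) 0 ρ := by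
  have ha : AnalyticOnNhd ℂ f (closedBall 0 |ρ|) := fun z _ => hf.analyticAt z
  have hD : ∀ z, 0 ≤ MeromorphicOn.divisor f (closedBall 0 |ρ|) z := fun z =>
    MeromorphicOn.AnalyticOnNhd.divisor_nonneg ha z
  rw [MeromorphicOn.circleAverage_log_norm (by positivity) ha.meromorphicOn]
  have h1 : 0 ≤ ∑ᶠ z, (MeromorphicOn.divisor f (closedBall 0 |ρ|) z : ℝ)
      * Real.log (ρ * ‖(0 : ℂ) - z‖⁻¹) := by
    refine finsum_nonneg fun z => ?_
    by_cases hz : z ∈ closedBall (0 : ℂ) |ρ|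
    · refine mul_nonneg (by exact_mod_cast hD z) ?_
      by_cases hz0 : z = 0
      · simp [hz0]
      · refine Real.log_nonneg ?_
        rw [zero_sub, norm_neg, ← div_eq_mul_inv, one_le_div (norm_pos_iff.2 hz0)]
        simpa [abs_of_nonneg (zero_le_one.trans hρ)] using hz
    · simp [hz]
  have h2 : 0 ≤ (MeromorphicOn.divisor f (closedBall 0 |ρ|) 0 : ℝ) * Real.log ρ :=
    mul_nonneg (by exact_mod_cast hD 0) (Real.log_nonneg hρ)
  linarith

/-- At a zero of `f` the convention `Real.log 0 = 0` may break the pointwise bound. Zeros are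
discrete since `f` is not identically zero, so replacing the integrand by `h` there does not change
the average. -/
theorem circleAverage_log_norm_le {f : ℂ → ℂ} (hf : Differentiable ℂ f) {z₀ : ℂ} (h0 : f z₀ ≠ 0)
    {ρ : ℝ} (hρ : ρ ≠ 0) {h : ℂ → ℝ} (hh : CircleIntegrable h 0 ρ)
    (hle : ∀ z ∈ sphere (0 : ℂ) |ρ|, f z ≠ 0 → Real.log ‖f z‖ ≤ h z) :
    circleAverage (fun z => Real.log ‖f z‖) 0 ρ ≤ circleAverage h 0 ρ := by
  classical
  have hcod : ∀ᶠ z in codiscreteWithin (sphere (0 : ℂ) |ρ|), f z ≠ 0 := by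
    have ha : AnalyticOnNhd ℂ f Set.univ := fun z _ => hf.analyticAt z
    have := ha.preimage_zero_mem_codiscrete h0
    refine (Filter.codiscreteWithin_mono (Set.subset_univ _)) ?_
    filter_upwards [this] with z hz
    simpa using hz
  let F : ℂ → ℝ := fun z => if f z = 0 then h z else Real.log ‖f z‖
  have hF : (fun z => Real.log ‖f z‖) =ᶠ[codiscreteWithin (sphere (0 : ℂ) |ρ|)] F := by
    filter_upwards [hcod] with z hz
    simp [F, hz]
  have hi : CircleIntegrable (fun z => Real.log ‖f z‖) 0 ρ :=
    MeromorphicOn.circleIntegrable_log_norm fun z _ => (hf.analyticAt z).meromorphicAt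
  rw [circleAverage_congr_codiscreteWithin hF hρ]
  refine circleAverage_mono (hi.congr_codiscreteWithin hF) hh fun z hz => ?_
  by_cases hfz : f z = 0
  · simp [F, hfz]
  · simpa [F, hfz] using hle z hz hfz

/-- The transition function of a holomorphic line bundle with a nonzero section has nonnegative
winding number. -/
theorem HasWinding.nonneg {u f g : ℂ → ℂ} {d : ℤ} (h : HasWinding u d)
    (hu : DifferentiableOn ℂ u {0}ᶜ)
    (hf : Differentiable ℂ f) (hg : Differentiable ℂ g) {z₀ : ℂ} (h0 : f z₀ ≠ 0)
    (hfg : ∀ z, z ≠ 0 → f z = u z * g z⁻¹) : 0 ≤ d := by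
  obtain ⟨C, hC⟩ := h.circleAverage_log_norm
  obtain ⟨M, hM⟩ := (isCompact_closedBall (0 : ℂ) 1).exists_bound_of_continuousOn
    hg.continuous.continuousOn
  have hM' : ∀ z ∈ closedBall (0 : ℂ) 1, ‖g z‖ ≤ |M| := fun z hz => (hM z hz).trans (le_abs_self M)
  by_contra hd
  have hd1 : (d : ℝ) ≤ -1 := by exact_mod_cast (by omega : d ≤ -1)
  -- On the circle of radius `exp τ` the average of `log ‖f‖` is bounded below by Jensen, and above
  -- by that of `log ‖u‖` plus a bound for `g` on the unit disc. For `d ≤ -1` this fails for large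
  -- `τ`.
  have key : ∀ τ : ℝ, 0 ≤ τ →
      Real.log ‖meromorphicTrailingCoeffAt f 0‖ ≤ d * τ + C + Real.log |M| := by
    intro τ hτ
    have hρ : (1 : ℝ) ≤ Real.exp τ := Real.one_le_exp hτ
    have hsph : ∀ z ∈ sphere (0 : ℂ) |Real.exp τ|, ‖z‖ = Real.exp τ := by
      intro z hz
      simpa using hz
    have hsph0 : ∀ z ∈ sphere (0 : ℂ) |Real.exp τ|, z ≠ 0 := by
      intro z hz h0
      have := hsph z hz
      rw [h0, norm_zero] at this
      exact (Real.exp_pos τ).ne this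
    have hcont : ContinuousOn (fun z => Real.log ‖u z‖) (sphere (0 : ℂ) |Real.exp τ|) := by
      refine ContinuousOn.log ?_ fun z hz => norm_ne_zero_iff.2 (h.ne_zero (hsph0 z hz))
      exact (hu.continuousOn.mono fun z hz => hsph0 z hz).norm
    have hint : CircleIntegrable (fun z => Real.log ‖u z‖) 0 (Real.exp τ) :=
      ContinuousOn.circleIntegrable' hcont
    have hintc : CircleIntegrable (fun _ : ℂ => Real.log |M|) 0 (Real.exp τ) :=
      circleIntegrable_const _ _ _
    have h1 := log_norm_trailingCoeff_le_circleAverage hf hρ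
    have h2 := circleAverage_log_norm_le hf h0 (Real.exp_pos τ).ne' (hint.fun_add hintc)
      (by
        intro z hz hfz
        rw [hfg z (hsph0 z hz)] at hfz ⊢
        have hgz : g z⁻¹ ≠ 0 := right_ne_zero_of_mul hfz
        rw [norm_mul, Real.log_mul (norm_ne_zero_iff.2 (left_ne_zero_of_mul hfz))
          (norm_ne_zero_iff.2 hgz)]
        gcongr
        refine hM' _ ?_
        simp only [mem_closedBall, dist_zero_right, norm_inv, hsph z hz]
        exact inv_le_one_of_one_le₀ hρ)
    rw [circleAverage_fun_add hint hintc, hC, circleAverage_const] at h2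
    exact h1.trans h2
  set L := Real.log ‖meromorphicTrailingCoeffAt f 0‖
  set B := C + Real.log |M| - L
  have := key (|B| + 1) (by positivity)
  nlinarith [le_abs_self B, abs_nonneg B]

theorem exists_eq_sub_mul {f : ℂ → ℂ} (hf : Differentiable ℂ f) {c : ℂ} (h : f c = 0) :
    ∃ g : ℂ → ℂ, Differentiable ℂ g ∧ ∀ z, f z = (z - c) * g z := by
  refine ⟨dslope f c, ?_, fun z => ?_⟩
  · rw [← differentiableOn_univ, Complex.differentiableOn_dslope Filter.univ_mem]
    exact hf.differentiableOn
  · have := sub_smul_dslope f c z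
    rw [h, sub_zero, smul_eq_mul] at this
    exact this.symm

theorem differentiableOn_zpow_mul {u : ℂ → ℂ} (hu : DifferentiableOn ℂ u {0}ᶜ) (j : ℤ) :
    DifferentiableOn ℂ (fun z => z ^ j * u z) {0}ᶜ := fun z hz =>
  (differentiableAt_zpow.2 (Or.inl hz)).differentiableWithinAt.fun_mul (hu z hz)

/-- If a nonzero section of a holomorphic line bundle has a zero, then the winding number of the
transition function is positive. -/
theorem HasWinding.pos_of_zero {u f g : ℂ → ℂ} {d : ℤ} (h : HasWinding u d)
    (hu : DifferentiableOn ℂ u {0}ᶜ)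
    (hf : Differentiable ℂ f) (hg : Differentiable ℂ g) {z₀ : ℂ} (h0 : f z₀ ≠ 0)
    (hfg : ∀ z, z ≠ 0 → f z = u z * g z⁻¹) (hz : (∃ z, f z = 0) ∨ ∃ w, g w = 0) : 0 < d := by
  have hw := h.mul_zpow (-1)
  have hu' := differentiableOn_zpow_mul hu (-1)
  -- Dividing out one zero of the section multiplies the transition function by `z⁻¹`; nonnegativity
  -- is then applied to the quotient.
  suffices 0 ≤ d + -1 by omega
  by_cases hg0 : g 0 = 0
  · obtain ⟨g₁, hg₁, hgg⟩ := exists_eq_sub_mul hg hg0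
    refine hw.nonneg hu' hf hg₁ h0 fun z hz => ?_
    rw [hfg z hz, hgg, zpow_neg_one]
    ring
  have hc : ∃ c, f c = 0 := by
    rcases hz with hz | ⟨w, hw⟩
    · exact hz
    · have hw0 : w ≠ 0 := by rintro rfl; exact hg0 hw
      exact ⟨w⁻¹, by rw [hfg _ (inv_ne_zero hw0), inv_inv, hw, mul_zero]⟩
  obtain ⟨c, hc⟩ := hc
  obtain ⟨f₁, hf₁, hff⟩ := exists_eq_sub_mul hf hc
  have h0' : f₁ z₀ ≠ 0 := fun h => h0 (by rw [hff, h, mul_zero])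
  by_cases hc0 : c = 0
  · refine hw.nonneg hu' hf₁ hg h0' fun z hz => ?_
    have := hff z
    rw [hfg z hz, hc0, sub_zero] at this
    rw [zpow_neg_one, mul_assoc, this]
    field_simp
  · have hgc : g c⁻¹ = 0 := by
      have := hfg c hc0
      rw [hc] at this
      exact (mul_eq_zero.1 this.symm).resolve_left (h.ne_zero hc0)
    obtain ⟨g₁, hg₁, hgg⟩ := exists_eq_sub_mul hg hgc
    have hdiff : Differentiable ℂ fun w => -c⁻¹ * g₁ w := hg₁.const_mul _
    -- From `z⁻¹ - c⁻¹ = -c⁻¹ z⁻¹ (z - c)`. The point `z = c` is recovered afterwards by continuity.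
    have heq : ∀ z, z ≠ 0 → z ≠ c → f₁ z = z ^ (-1 : ℤ) * u z * (-c⁻¹ * g₁ z⁻¹) := by
      intro z hz hzc
      have h1 := hff z
      rw [hfg z hz, hgg] at h1
      have h2 : z - c ≠ 0 := sub_ne_zero.2 hzc
      apply mul_left_cancel₀ h2
      rw [← h1, zpow_neg_one]
      field_simp
      ring
    refine hw.nonneg hu' hf₁ hdiff h0' fun z hz => ?_
    by_cases hzc : z = c
    · have hl : Tendsto f₁ (𝓝[≠] z) (𝓝 (f₁ z)) := (hf₁ z).continuousAt.mono_left nhdsWithin_le_nhds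
      have hr : Tendsto (fun z => z ^ (-1 : ℤ) * u z * (-c⁻¹ * g₁ z⁻¹)) (𝓝[≠] z)
          (𝓝 (z ^ (-1 : ℤ) * u z * (-c⁻¹ * g₁ z⁻¹))) := by
        have h1 := (hu'.differentiableAt (isOpen_compl_singleton.mem_nhds hz)).continuousAt
        have h2 : ContinuousAt (fun z => -c⁻¹ * g₁ z⁻¹) z :=
          (hdiff.continuous.continuousAt (x := z⁻¹)).comp (continuousAt_inv₀ hz)
        exact (h1.mul h2).mono_left nhdsWithin_le_nhds
      refine tendsto_nhds_unique (hl.congr' ?_) hr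
      filter_upwards [self_mem_nhdsWithin,
        nhdsWithin_le_nhds (isOpen_compl_singleton.mem_nhds hz)] with y hy hy0
      exact heq y hy0 (by rw [← hzc]; exact hy)
    · exact heq z hz hzc

end ParHiggs

end

/-! ### Induced parabolic structures, constant sub-bundles and minors. -/

noncomputable section

namespace ParHiggs

theorem constFlag_comap {W W' : Type} [AddCommGroup W] [Module ℂ W] [AddCommGroup W'] [Module ℂ W']
    (c : ℝ) (h0 : 0 ≤ c) (h1 : c < 1) (i : W' →ₗ[ℂ] W) (hi : Function.Injective i) :
    (constFlag W c h0 h1).comap i hi = constFlag W' c h0 h1 := by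
  have h : (fun t => ((constFlag W c h0 h1).filt t).comap i) = (constFlag W' c h0 h1).filt := by
    funext t
    by_cases ht : t ≤ c
    · simp [constFlag, ht]
    · simp [constFlag, ht, LinearMap.ker_eq_bot.2 hi]
  simp only [WeightedFlag.comap, h]

theorem constPar_induced_parDegree {s : ℕ} (x : Fin s → OnePoint ℂ) (r : ℕ) (n : ℤ)
    (c : Fin s → ℝ) (h0 : ∀ j, 0 ≤ c j) (h1 : ∀ j, c j < 1) {m : ℕ}
    (F : Subbundle (twist r n) m) :
    ParBundle.parDegree ((constPar x r n c h0 h1).induced F) = F.bundle.degree + m * ∑ j, c j := by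
  unfold ParBundle.parDegree
  rw [Finset.mul_sum]
  congr 1
  refine Finset.sum_congr rfl fun j _ => ?_
  rw [← constFlag_totalWeight m (c j) (h0 j) (h1 j),
    ← constFlag_comap (c j) (h0 j) (h1 j) (F.fibreMap (x j)) (F.fibreMap_injective (x j))]
  rfl

/-- The constant sub-bundle `L(ℂ^m) ⊗ 𝒪(n)` of `ℂ^r ⊗ 𝒪(n)`. -/
def constSubbundle {r m : ℕ} (n : ℤ) (L : (Fin m → ℂ) →ₗ[ℂ] (Fin r → ℂ))
    (hL : Function.Injective L) : Subbundle (twist r n) m where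
  bundle := twist m n
  incl₀ _ := LinearMap.toMatrix' L
  inclInf _ := LinearMap.toMatrix' L
  holo₀ i j := by simp
  holoInf i j := by simp
  compat z _ := by simp [twist]
  inj₀ z := by rwa [← Matrix.toLin'_apply', Matrix.toLin'_toMatrix']
  injInf z := by rwa [← Matrix.toLin'_apply', Matrix.toLin'_toMatrix']

theorem constSubbundle_fibreMap {r m : ℕ} (n : ℤ) (L : (Fin m → ℂ) →ₗ[ℂ] (Fin r → ℂ))
    (hL : Function.Injective L) (y : OnePoint ℂ) : (constSubbundle n L hL).fibreMap y = L := by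
  induction y using OnePoint.rec <;>
    simp [Subbundle.fibreMap, constSubbundle, ← Matrix.toLin'_apply']

theorem exists_constSubbundle {r : ℕ} (n : ℤ) (W : Submodule ℂ (Fin r → ℂ)) :
    ∃ F : Subbundle (twist r n) (Module.finrank ℂ W),
      F.bundle.degree = Module.finrank ℂ W * n ∧ ∀ y, LinearMap.range (F.fibreMap y) = W := by
  let e := (Module.finBasis ℂ W).equivFun
  let L : (Fin (Module.finrank ℂ W) → ℂ) →ₗ[ℂ] (Fin r → ℂ) := W.subtype ∘ₗ e.symm.toLinearMap
  have hL : Function.Injective L := W.injective_subtype.comp e.symm.injective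
  refine ⟨constSubbundle n L hL, twist_degree _ n, fun y => ?_⟩
  rw [constSubbundle_fibreMap, LinearMap.range_comp_of_range_eq_top _ (LinearEquiv.range _),
    Submodule.range_subtype]

theorem differentiable_matrix_det {m : ℕ} {M : ℂ → Matrix (Fin m) (Fin m) ℂ}
    (h : ∀ i j, Differentiable ℂ fun z => M z i j) : Differentiable ℂ fun z => (M z).det := by
  simp only [Matrix.det_apply]
  fun_prop

theorem differentiable_matrix_inv {m : ℕ} {M : ℂ → Matrix (Fin m) (Fin m) ℂ}
    (h : ∀ i j, Differentiable ℂ fun z => M z i j) (h0 : ∀ z, (M z).det ≠ 0) (i j : Fin m) :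
    Differentiable ℂ fun z => (M z)⁻¹ i j := by
  have h1 : ∀ z, (M z)⁻¹ i j = ((M z).det)⁻¹ * ((M z).updateRow j (Pi.single i 1)).det := by
    intro z
    rw [Matrix.inv_def, Matrix.smul_apply, Ring.inverse_eq_inv', smul_eq_mul, Matrix.adjugate_apply]
  simp only [h1]
  refine ((differentiable_matrix_det h).inv h0).mul (differentiable_matrix_det fun k l => ?_)
  by_cases hk : k = j
  · subst hk
    simp
  · simpa [Matrix.updateRow_ne hk] using h k l

/-- A matrix with independent columns has a nonvanishing maximal minor. -/
theorem exists_submatrix_det_ne_zero {r m : ℕ} (M : Matrix (Fin r) (Fin m) ℂ)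
    (hM : Function.Injective M.mulVecLin) :
    ∃ S : Fin m → Fin r, (M.submatrix S id).det ≠ 0 := by
  have hrank : Module.finrank ℂ (Submodule.span ℂ (Set.range M.row)) = m := by
    rw [← Matrix.rank_eq_finrank_span_row, Matrix.rank, LinearMap.finrank_range_of_inj hM,
      Module.finrank_fin_fun]
  obtain ⟨f, hf, -, hli⟩ := Submodule.exists_fun_fin_finrank_span_eq ℂ (Set.range M.row)
  choose S hS using hf
  let e := finCongr hrank.symm
  refine ⟨S ∘ e, ?_⟩
  have : LinearIndependent ℂ (M.submatrix (S ∘ e) id).row := by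
    have h1 : (M.submatrix (S ∘ e) id).row = f ∘ e := funext fun i => hS (e i)
    rw [h1]
    exact hli.comp e e.injective
  rw [Matrix.linearIndependent_rows_iff_isUnit, Matrix.isUnit_iff_isUnit_det] at this
  exact this.ne_zero

theorem submatrix_det_ne_zero_of_surjective {r m : ℕ} {M : Matrix (Fin r) (Fin m) ℂ}
    (hM : Function.Injective M.mulVecLin) {S : Fin m → Fin r} (hS : Function.Surjective S) :
    (M.submatrix S id).det ≠ 0 := by
  intro h
  obtain ⟨v, hv, h0⟩ := Matrix.exists_mulVec_eq_zero_iff.2 h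
  refine hv (hM ?_)
  rw [map_zero]
  funext i
  obtain ⟨k, rfl⟩ := hS i
  exact congrFun h0 k

/-- Liouville on the sphere: `f` is bounded on the unit disc by compactness and outside it by the
bound for `g` on that disc. -/
theorem eq_const_of_eq_comp_inv {f g : ℂ → ℂ} (hf : Differentiable ℂ f) (hg : Differentiable ℂ g)
    (h : ∀ z, z ≠ 0 → f z = g z⁻¹) : (∀ z, f z = f 0) ∧ ∀ w, g w = f 0 := by
  have main : ∀ {f g : ℂ → ℂ}, Differentiable ℂ f → Differentiable ℂ g →
      (∀ z, z ≠ 0 → f z = g z⁻¹) → ∀ z w, f z = f w := by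
    intro f g hf hg h z w
    obtain ⟨M, hM⟩ := (isCompact_closedBall (0 : ℂ) 1).exists_bound_of_continuousOn
      hf.continuous.continuousOn
    obtain ⟨M', hM'⟩ := (isCompact_closedBall (0 : ℂ) 1).exists_bound_of_continuousOn
      hg.continuous.continuousOn
    refine hf.apply_eq_apply_of_bounded ?_ z w
    refine isBounded_iff_forall_norm_le.2 ⟨max M M', ?_⟩
    rintro _ ⟨z, rfl⟩
    by_cases hz : ‖z‖ ≤ 1
    · exact (hM z (by simpa using hz)).trans (le_max_left _ _)
    · have hz0 : z ≠ 0 := by rintro rfl; simp at hz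
      rw [h z hz0]
      refine (hM' _ ?_).trans (le_max_right _ _)
      simpa using inv_le_one_of_one_le₀ (not_le.1 hz).le
  refine ⟨fun z => main hf hg h z 0, fun w => ?_⟩
  have h' : ∀ z, z ≠ 0 → g z = f z⁻¹ := fun z hz => by rw [h _ (inv_ne_zero hz), inv_inv]
  rw [main hg hf h' w 1, main hf hg h 0 1, h 1 one_ne_zero, inv_one]

/-! ### Degrees of sub-bundles of `ℂ^r ⊗ 𝒪(n)`. -/

namespace Subbundle

variable {r m : ℕ} {n : ℤ}

theorem rank_le {E : HolBundle r} (F : Subbundle E m) : m ≤ r := by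
  simpa using LinearMap.finrank_le_finrank_of_injective (F.inj₀ 0)

theorem finrank_eq_of_range_eq {E : HolBundle r} {F : Subbundle E m} {y : OnePoint ℂ}
    {W : Submodule ℂ (Fin r → ℂ)} (h : LinearMap.range (F.fibreMap y) = W) :
    Module.finrank ℂ W = m := by
  rw [← h, LinearMap.finrank_range_of_inj (F.fibreMap_injective y), Module.finrank_fin_fun]

theorem twist_compat (F : Subbundle (twist r n) m) {z : ℂ} (hz : z ≠ 0) :
    F.inclInf z⁻¹ * F.bundle.T z = z ^ (-n) • F.incl₀ z := by
  rw [F.compat z hz]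
  simp [twist]

theorem minor_compat (F : Subbundle (twist r n) m) (S : Fin m → Fin r) {z : ℂ} (hz : z ≠ 0) :
    (F.inclInf z⁻¹).submatrix S id * F.bundle.T z = z ^ (-n) • (F.incl₀ z).submatrix S id := by
  have h := congrArg (fun M => Matrix.submatrix M S id) (F.twist_compat hz)
  rw [Matrix.submatrix_mul _ _ S id id Function.bijective_id, Matrix.submatrix_id_id] at h
  exact h

/-- Puts the minor in the form `f z = u z * g z⁻¹` needed for `HasWinding.nonneg`. The winding
number of `u` is `mn` minus the degree of `F`. -/
theorem det_minor_compat (F : Subbundle (twist r n) m) (S : Fin m → Fin r) {z : ℂ} (hz : z ≠ 0) :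
    ((F.incl₀ z).submatrix S id).det
      = z ^ (n * m) * (F.bundle.T z).det * ((F.inclInf z⁻¹).submatrix S id).det := by
  have h := congrArg Matrix.det (F.minor_compat S hz)
  rw [Matrix.det_mul, Matrix.det_smul, Fintype.card_fin, ← zpow_natCast, ← zpow_mul] at h
  rw [mul_assoc, mul_comm (F.bundle.T z).det, h, ← mul_assoc, ← zpow_add₀ hz]
  have : n * m + -n * (m : ℤ) = 0 := by ring
  rw [this, zpow_zero, one_mul]

theorem range_mulVecLin_mul_inv (M : Matrix (Fin r) (Fin m) ℂ) {X : Matrix (Fin m) (Fin m) ℂ}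
    (hX : X.det ≠ 0) : LinearMap.range (M * X⁻¹).mulVecLin = LinearMap.range M.mulVecLin := by
  rw [Matrix.mulVecLin_mul]
  refine LinearMap.range_comp_of_range_eq_top _ (LinearMap.range_eq_top.2 fun v => ⟨X.mulVec v, ?_⟩)
  simp [Matrix.nonsing_inv_mul X (isUnit_iff_ne_zero.2 hX)]

/-- A sub-bundle of `ℂ^r ⊗ 𝒪(n)` with a nowhere vanishing maximal minor is constant. -/
theorem exists_range_eq_of_minor_ne_zero (F : Subbundle (twist r n) m) (S : Fin m → Fin r)
    (h₀ : ∀ z, ((F.incl₀ z).submatrix S id).det ≠ 0)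
    (hinf : ∀ w, ((F.inclInf w).submatrix S id).det ≠ 0) :
    ∃ W : Submodule ℂ (Fin r → ℂ), ∀ y, LinearMap.range (F.fibreMap y) = W := by
  let N₀ : ℂ → Matrix (Fin r) (Fin m) ℂ := fun z => F.incl₀ z * ((F.incl₀ z).submatrix S id)⁻¹
  let NInf : ℂ → Matrix (Fin r) (Fin m) ℂ :=
    fun w => F.inclInf w * ((F.inclInf w).submatrix S id)⁻¹
  -- Normalizing by the minor cancels both the transition matrix of `F` and the scalar `z ^ (-n)`,
  -- so the two charts define one matrix-valued function on the sphere.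
  have hN : ∀ z, z ≠ 0 → N₀ z = NInf z⁻¹ := by
    intro z hz
    have h1 : NInf z⁻¹ * (F.inclInf z⁻¹).submatrix S id = F.inclInf z⁻¹ :=
      Matrix.nonsing_inv_mul_cancel_right _ _ (isUnit_iff_ne_zero.2 (hinf _))
    have h2 : NInf z⁻¹ * (F.incl₀ z).submatrix S id = F.incl₀ z := by
      have h3 : z ^ (-n) • (NInf z⁻¹ * (F.incl₀ z).submatrix S id) = z ^ (-n) • F.incl₀ z := by
        rw [← Matrix.mul_smul, ← F.minor_compat S hz, ← Matrix.mul_assoc, h1, F.twist_compat hz]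
      exact smul_right_injective _ (zpow_ne_zero (-n) hz) h3
    calc N₀ z = NInf z⁻¹ * (F.incl₀ z).submatrix S id * ((F.incl₀ z).submatrix S id)⁻¹ := by
          rw [h2]
      _ = NInf z⁻¹ := Matrix.mul_nonsing_inv_cancel_right _ _ (isUnit_iff_ne_zero.2 (h₀ z))
  have hd₀ : ∀ i j, Differentiable ℂ fun z => N₀ z i j := by
    intro i j
    have h1 := differentiable_matrix_inv (fun k l => F.holo₀ (S k) l) h₀
    have h2 := F.holo₀
    simp only [N₀, Matrix.mul_apply]
    exact Differentiable.fun_sum fun k _ => (h2 i k).mul (h1 k j)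
  have hdInf : ∀ i j, Differentiable ℂ fun z => NInf z i j := by
    intro i j
    have h1 := differentiable_matrix_inv (fun k l => F.holoInf (S k) l) hinf
    have h2 := F.holoInf
    simp only [NInf, Matrix.mul_apply]
    exact Differentiable.fun_sum fun k _ => (h2 i k).mul (h1 k j)
  have hc := fun i j => eq_const_of_eq_comp_inv (hd₀ i j) (hdInf i j) fun z hz => by rw [hN z hz]
  refine ⟨LinearMap.range (N₀ 0).mulVecLin, fun y => ?_⟩
  induction y using OnePoint.rec with
  | infty =>
    rw [← Matrix.ext fun i j => (hc i j).2 0, range_mulVecLin_mul_inv _ (hinf 0)]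
    rfl
  | coe z =>
    rw [← Matrix.ext fun i j => (hc i j).1 z, range_mulVecLin_mul_inv _ (h₀ z)]
    rfl

/-- A sub-bundle of rank `m` of `ℂ^r ⊗ 𝒪(n)` has degree `≤ mn`, and it is constant in case of
equality, which holds in particular if `m = 0` or `m = r`. -/
theorem exists_degree_eq (F : Subbundle (twist r n) m) :
    ∃ d : ℕ, F.bundle.degree = m * n - d ∧
      (d = 0 → ∃ W : Submodule ℂ (Fin r → ℂ), ∀ y, LinearMap.range (F.fibreMap y) = W) ∧
      (m = 0 ∨ m = r → d = 0) := by
  obtain ⟨S, hS⟩ := exists_submatrix_det_ne_zero _ (F.inj₀ 0)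
  have hT : DifferentiableOn ℂ (fun z => (F.bundle.T z).det) {0}ᶜ := by
    have := F.bundle.holo
    simp only [Matrix.det_apply]
    fun_prop
  obtain ⟨e, he⟩ := exists_hasWinding hT F.bundle.det_ne_zero
  have hdeg : F.bundle.degree = -e := by
    rw [HolBundle.degree, he.circleIntegral_logDeriv hT]
    have : -(2 * (Real.pi : ℂ) * Complex.I)⁻¹ * (e * (2 * Real.pi * Complex.I))
        = ((-e : ℝ) : ℂ) := by
      have hpi : (2 * (Real.pi : ℂ) * Complex.I) ≠ 0 := Complex.two_pi_I_ne_zero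
      push_cast
      field_simp
    rw [this, Complex.ofReal_re]
  have hw := he.mul_zpow (n * m)
  have hu := differentiableOn_zpow_mul hT (n * m)
  have hf : Differentiable ℂ fun z => ((F.incl₀ z).submatrix S id).det :=
    differentiable_matrix_det fun i j => F.holo₀ (S i) j
  have hg : Differentiable ℂ fun w => ((F.inclInf w).submatrix S id).det :=
    differentiable_matrix_det fun i j => F.holoInf (S i) j
  have hfg := fun z (hz : z ≠ 0) => F.det_minor_compat S hz
  have hnn := hw.nonneg hu hf hg hS hfg
  obtain ⟨d, hd⟩ := Int.eq_ofNat_of_zero_le hnn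
  refine ⟨d, ?_, fun hd0 => ?_, fun hm => ?_⟩
  · have : (e : ℝ) + n * m = d := by exact_mod_cast hd
    rw [hdeg]
    linarith
  · have hno := fun hz => (hw.pos_of_zero hu hf hg hS hfg hz).ne' (by omega)
    exact F.exists_range_eq_of_minor_ne_zero S (fun z hz => hno (Or.inl ⟨z, hz⟩))
      fun w hw => hno (Or.inr ⟨w, hw⟩)
  · have hne : (∀ z, ((F.incl₀ z).submatrix S id).det ≠ 0) ∧
        ∀ w, ((F.inclInf w).submatrix S id).det ≠ 0 := by
      rcases hm with rfl | rfl
      · simp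
      · have hinj : Function.Injective S := by
          intro i j hij
          by_contra hne
          exact hS (Matrix.det_zero_of_row_eq hne (by funext k; simp [hij]))
        have hsurj := Finite.surjective_of_injective hinj
        exact ⟨fun z => submatrix_det_ne_zero_of_surjective (F.inj₀ z) hsurj,
          fun w => submatrix_det_ne_zero_of_surjective (F.injInf w) hsurj⟩
    -- The inverse of a nowhere vanishing minor is a section of the dual line bundle, so `-d ≥ 0` as
    -- well.
    have := hw.inv.nonneg (hu.fun_inv fun z hz => hw.ne_zero hz) (hf.fun_inv hne.1)
      (hg.fun_inv hne.2) (inv_ne_zero hS) fun z hz => by rw [hfg z hz, mul_inv]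
    omega

end Subbundle

end ParHiggs

end

/-! ### Parabolic degrees and invariant pairs. -/

noncomputable section

namespace ParHiggs

variable {p q s : ℕ} {a : ℤ} {α β : Fin s → ℝ}

theorem ConstWeights.parDegree_const (hW : ConstWeights p q s a α β) (hp : 0 < p) (m n : ℕ) :
    (m * ((-a + 1 : ℤ) : ℝ) + m * ∑ j, α j) + (n * ((-a : ℤ) : ℝ) + n * ∑ j, β j)
      = (1 - ∑ j, (β j - α j)) / (p + q) * (m * q - n * p) := by
  have h := hW.degree_zero
  have hpq : (p : ℝ) + q ≠ 0 := by positivity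
  rw [Finset.sum_sub_distrib]
  push_cast
  field_simp
  linear_combination (m + n : ℝ) * h

/-- The bound `hW.lower` says exactly that `(1 - ε)(2pq - p - q) < p + q`, so the positive part is
less than `1` once `mq - np ≤ 2pq - p - q`, while the defect is at least `1`. The extreme pair `m =
p`, `n = 0` has no defect and must be excluded. -/
theorem ConstWeights.parDegree_neg (hW : ConstWeights p q s a α β) (hp : 0 < p) (hq : 0 < q)
    {m n d₁ d₂ : ℕ} (hm : m ≤ p) (h₁ : m = p → d₁ = 0) (h₂ : n = 0 → d₂ = 0) (hd : d₁ + d₂ ≠ 0) :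
    (1 - ∑ j, (β j - α j)) / (p + q) * (m * q - n * p) - (d₁ + d₂ : ℕ) < (0 : ℝ) := by
  have hlow := hW.lower
  have hup := hW.upper
  set ε := ∑ j, (β j - α j)
  have hp1 : (1 : ℝ) ≤ p := by exact_mod_cast hp
  have hq1 : (1 : ℝ) ≤ q := by exact_mod_cast hq
  -- If `m < p` the left side is at most `pq - q`; if `m = p`, the defect comes from `V'`, so `n ≥
  -- 1` and it is at most `pq - p`.
  have hN : (m * q - n * p : ℝ) ≤ 2 * p * q - p - q := by
    rcases hm.lt_or_eq with hlt | rfl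
    · have : (m : ℝ) + 1 ≤ p := by exact_mod_cast hlt
      nlinarith [mul_nonneg (Nat.cast_nonneg (α := ℝ) n) (Nat.cast_nonneg (α := ℝ) p)]
    · have hn : n ≠ 0 := fun h => hd (by rw [h₁ rfl, h₂ h])
      have : (1 : ℝ) ≤ n := by exact_mod_cast Nat.one_le_iff_ne_zero.2 hn
      nlinarith
  have hd1 : (1 : ℝ) ≤ (d₁ + d₂ : ℕ) := by exact_mod_cast Nat.one_le_iff_ne_zero.2 hd
  have hlt : (1 - ε) / (p + q) * (m * q - n * p) < 1 := by
    rw [div_mul_eq_mul_div, div_lt_one (by positivity)]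
    nlinarith
  linarith

variable {x : Fin s → OnePoint ℂ} {b : Module.Basis (Fin (s - 2)) ℂ (Polynomial.degreeLT ℂ (s - 2))}
  {A : Fin (s - 2) → (Fin p → ℂ) →ₗ[ℂ] (Fin q → ℂ)}

theorem gammaA_fibreMap_coe (z : ℂ) (v : Fin p → ℂ) :
    (gammaA x a b A).fibreMap z v = ∑ j, (b j : Polynomial ℂ).eval z • A j v := by
  simp [LogHom.fibreMap, gammaA, ← Matrix.toLin'_apply]

theorem gammaA_fibreMap_infty (v : Fin p → ℂ) :
    (gammaA x a b A).fibreMap OnePoint.infty v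
      = -transConst x • ∑ j, ((b j : Polynomial ℂ).reflect (s - 3)).eval 0 • A j v := by
  simp [LogHom.fibreMap, gammaA, ← Matrix.toLin'_apply]

/-- The section `γ_A` maps a constant sub-bundle into another one if and only if all the
coefficients `A j` do. -/
theorem gammaA_map_le_iff {W₁ : Submodule ℂ (Fin p → ℂ)} {W₂ : Submodule ℂ (Fin q → ℂ)} :
    (∀ y, W₁.map ((gammaA x a b A).fibreMap y) ≤ W₂) ↔ ∀ j, W₁.map (A j) ≤ W₂ := by
  simp only [Submodule.map_le_iff_le_comap]
  constructor
  · intro h j v hv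
    rw [Submodule.mem_comap]
    by_contra hA
    -- A functional vanishing on `W₂` but not at `A j v` turns invariance at all finite points into
    -- a linear relation among the `b i`.
    obtain ⟨ℓ, hℓ, hℓW⟩ := Submodule.exists_le_ker_of_notMem hA
    have hsum : ∑ i, ℓ (A i v) • (b i : Polynomial ℂ) = 0 := by
      refine Polynomial.funext fun z => ?_
      have h1 : (gammaA x a b A).fibreMap z v ∈ W₂ := h z hv
      have h2 := LinearMap.mem_ker.1 (hℓW h1)
      rw [gammaA_fibreMap_coe] at h2
      simpa [Polynomial.eval_finsetSum, mul_comm] using h2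
    have hsum' : ∑ i, ℓ (A i v) • b i = 0 := by
      apply Subtype.ext
      simpa using hsum
    exact hℓ (Fintype.linearIndependent_iff.1 b.linearIndependent _ hsum' j)
  · intro h y v hv
    rw [Submodule.mem_comap]
    induction y using OnePoint.rec with
    | infty =>
      rw [gammaA_fibreMap_infty]
      exact W₂.smul_mem _ (W₂.sum_mem fun j _ => W₂.smul_mem _ (h j hv))
    | coe z =>
      rw [gammaA_fibreMap_coe]
      exact W₂.sum_mem fun j _ => W₂.smul_mem _ (h j hv)

theorem LogHom.zero_fibreMap (E : HolBundle p) (F : HolBundle q) (y : OnePoint ℂ) :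
    (LogHom.zero x E F).fibreMap y = 0 := by
  induction y using OnePoint.rec <;> simp [LogHom.fibreMap, LogHom.zero]

variable (hW : ConstWeights p q s a α β)

theorem higgsOf_invariant_iff {m n : ℕ} (U' : Subbundle (twist p (-a + 1)) m)
    (V' : Subbundle (twist q (-a)) n) :
    (higgsOf x a α β hW b A).Invariant U' V' ↔ ∀ y,
      (LinearMap.range (U'.fibreMap y)).map ((gammaA x a b A).fibreMap y)
        ≤ LinearMap.range (V'.fibreMap y) := by
  refine forall_congr' fun y => and_iff_left ?_
  have : (higgsOf x a α β hW b A).δ.fibreMap y = 0 := LogHom.zero_fibreMap _ _ y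
  rw [this, Submodule.map_zero]
  exact bot_le

/-- A pair of subspaces preserved by the `A j` gives an invariant sub-bundle. -/
theorem higgsOf_exists_invariant (hp : 0 < p) {W₁ : Submodule ℂ (Fin p → ℂ)}
    {W₂ : Submodule ℂ (Fin q → ℂ)} (h : ∀ j, W₁.map (A j) ≤ W₂) :
    ∃ (U' : Subbundle (higgsOf x a α β hW b A).U.toHolBundle (Module.finrank ℂ W₁))
      (V' : Subbundle (higgsOf x a α β hW b A).V.toHolBundle (Module.finrank ℂ W₂)),
      (higgsOf x a α β hW b A).Invariant U' V' ∧
      ((higgsOf x a α β hW b A).U.induced U').parDegree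
          + ((higgsOf x a α β hW b A).V.induced V').parDegree
        = (1 - ∑ j, (β j - α j)) / (p + q)
          * (Module.finrank ℂ W₁ * q - Module.finrank ℂ W₂ * p) := by
  obtain ⟨U', hU, hU'⟩ := exists_constSubbundle (-a + 1) W₁
  obtain ⟨V', hV, hV'⟩ := exists_constSubbundle (-a) W₂
  refine ⟨U', V', (higgsOf_invariant_iff hW U' V').2 fun y => ?_, ?_⟩
  · rw [hU', hV']
    exact gammaA_map_le_iff.2 h y
  · rw [← hW.parDegree_const hp, ← hU, ← hV]
    exact congrArg₂ (· + ·) (constPar_induced_parDegree x p _ α _ _ U')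
      (constPar_induced_parDegree x q _ β _ _ V')

/-- An invariant sub-bundle has negative parabolic degree or is constant. -/
theorem higgsOf_parDegree_neg_or_const (hp : 0 < p) (hq : 0 < q) {m n : ℕ}
    (U' : Subbundle (higgsOf x a α β hW b A).U.toHolBundle m)
    (V' : Subbundle (higgsOf x a α β hW b A).V.toHolBundle n)
    (h : (higgsOf x a α β hW b A).Invariant U' V') :
    ((higgsOf x a α β hW b A).U.induced U').parDegree
        + ((higgsOf x a α β hW b A).V.induced V').parDegree < 0 ∨
    (((higgsOf x a α β hW b A).U.induced U').parDegree
        + ((higgsOf x a α β hW b A).V.induced V').parDegree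
        = (1 - ∑ j, (β j - α j)) / (p + q) * (m * q - n * p) ∧
      ∃ (W₁ : Submodule ℂ (Fin p → ℂ)) (W₂ : Submodule ℂ (Fin q → ℂ)),
        (∀ j, W₁.map (A j) ≤ W₂) ∧ Module.finrank ℂ W₁ = m ∧ Module.finrank ℂ W₂ = n) := by
  have hinv := (higgsOf_invariant_iff hW U' V').1 h
  obtain ⟨d₁, hd₁, hc₁, he₁⟩ := Subbundle.exists_degree_eq (r := p) (n := -a + 1) U'
  obtain ⟨d₂, hd₂, hc₂, he₂⟩ := Subbundle.exists_degree_eq (r := q) (n := -a) V'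
  have hdeg : ((higgsOf x a α β hW b A).U.induced U').parDegree
        + ((higgsOf x a α β hW b A).V.induced V').parDegree
      = (1 - ∑ j, (β j - α j)) / (p + q) * (m * q - n * p) - (d₁ + d₂ : ℕ) := by
    rw [← hW.parDegree_const hp]
    refine (congrArg₂ (· + ·) (constPar_induced_parDegree x p _ α _ _ U')
      (constPar_induced_parDegree x q _ β _ _ V')).trans ?_
    rw [hd₁, hd₂]
    push_cast
    ring
  by_cases hd : d₁ + d₂ = 0
  · obtain ⟨h1, h2⟩ := Nat.add_eq_zero_iff.1 hd
    obtain ⟨W₁, hW₁⟩ := hc₁ h1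
    obtain ⟨W₂, hW₂⟩ := hc₂ h2
    refine Or.inr ⟨by rw [hdeg, hd, Nat.cast_zero, sub_zero], W₁, W₂, ?_, ?_, ?_⟩
    · refine (gammaA_map_le_iff (x := x) (a := a) (b := b)).1 fun y => ?_
      rw [← hW₁ y, ← hW₂ y]
      exact hinv y
    · exact Subbundle.finrank_eq_of_range_eq (hW₁ OnePoint.infty)
    · exact Subbundle.finrank_eq_of_range_eq (hW₂ OnePoint.infty)
  · left
    rw [hdeg]
    exact hW.parDegree_neg hp hq U'.rank_le (fun h => he₁ (Or.inr h)) (fun h => he₂ (Or.inl h)) hd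

/-! ### Comparison with King's conditions. -/

theorem ConstWeights.coeff_pos (hW : ConstWeights p q s a α β) (hp : 0 < p) :
    0 < (1 - ∑ j, (β j - α j)) / ((p : ℝ) + q) :=
  div_pos (by linarith [hW.upper]) (by positivity)

theorem semistable_iff_kingSemistable (hp : 0 < p) (hq : 0 < q) :
    (higgsOf x a α β hW b A).Semistable ↔ KingSemistable A := by
  have hp' : (0 : ℝ) < p := by exact_mod_cast hp
  have hκ := hW.coeff_pos hp
  constructor
  · intro h W₁ W₂ hA
    obtain ⟨U', V', hinv, hdeg⟩ := higgsOf_exists_invariant (x := x) (b := b) hW hp hA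
    have h1 := h _ _ U' V' hinv
    rw [hdeg] at h1
    have h2 := nonpos_of_mul_nonpos_right h1 hκ
    rw [div_mul_eq_mul_div, div_le_iff₀ hp']
    linarith
  · intro h m n U' V' hinv
    rcases higgsOf_parDegree_neg_or_const hW hp hq U' V' hinv with h1 | ⟨h1, W₁, W₂, hA, rfl, rfl⟩
    · exact h1.le
    · rw [h1]
      have h2 := h W₁ W₂ hA
      rw [div_mul_eq_mul_div, div_le_iff₀ hp'] at h2
      exact mul_nonpos_of_nonneg_of_nonpos hκ.le (by linarith)

/-- `Stable` says nothing about the pairs of ranks `(0, 0)` and `(p, q)`; for them `mq - np = 0`, so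
the parabolic degree is still `≤ 0`. -/
theorem semistable_of_stable (hp : 0 < p) (hq : 0 < q)
    (h : (higgsOf x a α β hW b A).Stable) : (higgsOf x a α β hW b A).Semistable := by
  intro m n U' V' hinv
  rcases higgsOf_parDegree_neg_or_const hW hp hq U' V' hinv with h1 | ⟨h1, -⟩
  · exact h1.le
  · by_cases h0 : m = 0 ∧ n = 0
    · rw [h1, h0.1, h0.2]
      simp
    by_cases h2 : m = p ∧ n = q
    · rw [h1, h2.1, h2.2, mul_comm (q : ℝ), sub_self, mul_zero]
    · exact (h m n U' V' hinv h0 h2).le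

theorem stable_iff_kingStable (hp : 0 < p) (hq : 0 < q) :
    (higgsOf x a α β hW b A).Stable ↔ KingStable A := by
  have hp' : (0 : ℝ) < p := by exact_mod_cast hp
  have hκ := hW.coeff_pos hp
  constructor
  · intro h
    refine ⟨(semistable_iff_kingSemistable hW hp hq).1 (semistable_of_stable hW hp hq h), ?_⟩
    intro W₁ W₂ hA heq
    obtain ⟨U', V', hinv, hdeg⟩ := higgsOf_exists_invariant (x := x) (b := b) hW hp hA
    -- Equality in King's inequality gives an invariant pair of parabolic degree `0`, which
    -- stability allows only at the extreme ranks.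
    have hzero : (Module.finrank ℂ W₁ * q - Module.finrank ℂ W₂ * p : ℝ) = 0 := by
      rw [heq]
      field_simp
      ring
    rw [hzero, mul_zero] at hdeg
    by_contra hne
    refine (h _ _ U' V' hinv (fun h0 => hne (Or.inl ?_)) (fun h0 => hne (Or.inr ?_))).ne hdeg
    · exact ⟨Submodule.finrank_eq_zero.1 h0.1, Submodule.finrank_eq_zero.1 h0.2⟩
    · exact ⟨Submodule.eq_top_of_finrank_eq (by rw [h0.1, Module.finrank_fin_fun]),
        Submodule.eq_top_of_finrank_eq (by rw [h0.2, Module.finrank_fin_fun])⟩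
  · rintro ⟨hss, h⟩ m n U' V' hinv h0 htop
    rcases higgsOf_parDegree_neg_or_const hW hp hq U' V' hinv with h1 | ⟨h1, W₁, W₂, hA, rfl, rfl⟩
    · exact h1
    · rw [h1]
      have h2 := hss W₁ W₂ hA
      have hne : (Module.finrank ℂ W₂ : ℝ) ≠ q / p * Module.finrank ℂ W₁ := by
        intro heq
        rcases h W₁ W₂ hA heq with ⟨rfl, rfl⟩ | ⟨rfl, rfl⟩
        · exact h0 (by simp)
        · exact htop (by simp)
      have h3 := lt_of_le_of_ne h2 hne.symm
      rw [div_mul_eq_mul_div, div_lt_iff₀ hp'] at h3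
      exact mul_neg_of_pos_of_neg hκ (by linarith)

end ParHiggs

end

theorem lemmal (p q s : ℕ) (hp : 0 < p) (hq : 0 < q) (hs : 3 ≤ s)
    (x : Fin s → OnePoint ℂ) (hx : Function.Injective x)
    (a : ℤ) (α β : Fin s → ℝ) (hW : ParHiggs.ConstWeights p q s a α β)
    (b : Module.Basis (Fin (s - 2)) ℂ (Polynomial.degreeLT ℂ (s - 2)))
    (A : Fin (s - 2) → (Fin p → ℂ) →ₗ[ℂ] (Fin q → ℂ)) :
    ((ParHiggs.higgsOf x a α β hW b A).Semistable ↔ ParHiggs.KingSemistable A) ∧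
    ((ParHiggs.higgsOf x a α β hW b A).Stable ↔ ParHiggs.KingStable A) :=
  ⟨ParHiggs.semistable_iff_kingSemistable hW hp hq, ParHiggs.stable_iff_kingStable hW hp hq⟩
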